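/- Let $\mathcal H$ be a nonzero complex Hilbert space (of arbitrary, in particular finite or countably infinite, dimension), and write $\mathcal L(\mathcal H)$ for the bounded operators on $\mathcal H$. An observable on $\mathcal H$ is a family $(\mathsf A(x))_{x\in\mathbb N}$ of positive operators in $\mathcal L(\mathcal H)$ with $\sum_x \mathsf A(x)=\mathbb 1$ in the weak operator topology. For observables $\mathsf A,\mathsf B$ on $\mathcal H$ write $\mathsf A\preceq\mathsf B$ if there are real numbers $M_{xy}\ge 0$ ($x,y\in\mathbb N$) with $\sum_x M_{xy}=1$ for all $y$ and $\mathsf A(x)=\sum_y M_{xy}\mathsf B(y)$ for all $x$ (weak operator topology). A channel from $\mathcal L(\mathcal K)$ to $\mathcal L(\mathcal K')$, where $\mathcal K,\mathcal K'$ are complex Hilbert spaces, is a normal completely positive linear map $\Lambda:\mathcal L(\mathcal K)\to\mathcal L(\mathcal K')$ with $\Lambda(\mathbb 1)=\mathbb 1$. For channels $\Lambda_i:\mathcal L(\mathcal K_i)\to\mathcal L(\mathcal H)$, $i=1,2$, write $\Lambda_1\precsim\Lambda_2$ if $\Lambda_1=\Lambda_2\circ\mathcal E$ for some channel $\mathcal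 E:\mathcal L(\mathcal K_1)\to\mathcal L(\mathcal K_2)$. A Naimark dilation of an observable $\mathsf A$ is a triple $(\mathcal K,\hat{\mathsf A},J)$ of a complex Hilbert space $\mathcal K$, an observable $\hat{\mathsf A}$ on $\mathcal K$ all of whose operators $\hat{\mathsf A}(x)$ are orthogonal projections, and an isometry $J:\mathcal H\to\mathcal K$ such that $J^*\hat{\mathsf A}(x)J=\mathsf A(x)$ for all $x$. The least disturbing channel of $\mathsf A$ given by this dilation is $$\Lambda_{\mathsf A}:\mathcal L(\mathcal K)\to\mathcal L(\mathcal H),\qquad \Lambda_{\mathsf A}(C)=\sum_x J^*\hat{\mathsf A}(x)\,C\,\hat{\mathsf A}(x)J .$$ Let $\mathsf A$ and $\mathsf B$ be two observables on $\mathcal H$, and let $\Lambda_{\mathsf A}$ and $\Lambda_{\mathsf B}$ be their least disturbing channels given by arbitrary Naimark dilations of $\mathsf A$ and of $\mathsf B$. Then $$\mathsf A\preceq\mathsf B\quad\Longleftrightarrow\quad \Lambda_{\mathsf B}\precsim\Lambda_{\mathsf A}.$$ -/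

import Mathlib

open scoped InnerProductSpace Topology

noncomputable section

namespace QuantumMeasurement

/-! ### Positivity of operators and of operator matrices -/

section Positivity

variable {H : Type*} [NormedAddCommGroup H] [InnerProductSpace ℂ H] [CompleteSpace H]

lemma exists_star_mul_self {A : Type*} [NonUnitalCStarAlgebra A] [PartialOrder A]
    [StarOrderedRing A] {a : A} (ha : 0 ≤ a) : ∃ b, a = star b * b :=
  CStarAlgebra.nonneg_iff_eq_star_mul_self.mp ha

/-- Positivity of a self-adjoint `a` tested on its negative part `p`. -/
lemma exists_negPart {A : Type*} [NonUnitalCStarAlgebra A] [PartialOrder A]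
    [StarOrderedRing A] {a : A} (hsa : IsSelfAdjoint a) :
    ∃ p : A, star p = p ∧ p * a * p = -(p * p * p) ∧ 0 ≤ p * p * p ∧
      (p * p * p = 0 → 0 ≤ a) := by
  have hPnn : 0 ≤ a⁻ := CFC.negPart_nonneg a
  have hPsa : star a⁻ = a⁻ := (IsSelfAdjoint.of_nonneg hPnn).star_eq
  refine ⟨a⁻, hPsa, ?_, ?_, ?_⟩
  · have h1 : a = a⁺ - a⁻ := (CFC.posPart_sub_negPart a hsa).symm
    have h2 : a⁻ * a⁺ = 0 := CFC.negPart_mul_posPart a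
    have h3 : a⁻ * a = -(a⁻ * a⁻) := by
      calc a⁻ * a = a⁻ * (a⁺ - a⁻) := by rw [← h1]
        _ = -(a⁻ * a⁻) := by rw [mul_sub, h2, zero_sub]
    rw [h3, neg_mul]
  · have := star_right_conjugate_nonneg hPnn a⁻
    rwa [hPsa] at this
  · intro h0
    have h4 : star (a⁻ * a⁻) * (a⁻ * a⁻) = 0 := by
      rw [star_mul, hPsa, ← mul_assoc, h0, zero_mul]
    have h2 := (CStarRing.star_mul_self_eq_zero_iff _).mp h4
    have h5 : star a⁻ * a⁻ = 0 := by rw [hPsa, h2]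
    exact (CFC.negPart_eq_zero_iff a hsa).mp ((CStarRing.star_mul_self_eq_zero_iff _).mp h5)

/-- A nonnegative operator matrix has a nonnegative quadratic form. -/
lemma re_sum_inner_nonneg {k : ℕ} {M : CStarMatrix (Fin k) (Fin k) (H →L[ℂ] H)} (hM : 0 ≤ M)
    (v : Fin k → H) : 0 ≤ (∑ i, ∑ j, ⟪v i, M i j (v j)⟫_ℂ).re := by
  obtain ⟨N, rfl⟩ := exists_star_mul_self hM
  have h : ∑ i, ∑ j, ⟪v i, (star N * N) i j (v j)⟫_ℂ
      = ∑ l, ⟪∑ i, N l i (v i), ∑ j, N l j (v j)⟫_ℂ := by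
    simp only [CStarMatrix.mul_apply, CStarMatrix.star_apply, sum_inner, inner_sum,
      _root_.sum_apply, mul_apply_eq_comp,
      ContinuousLinearMap.star_eq_adjoint, ContinuousLinearMap.adjoint_inner_right]
    rw [Finset.sum_comm' (t' := Finset.univ) (s' := fun _ => Finset.univ) (by simp)]
    have : ∀ j, ∑ x, ∑ i, ⟪(N i x) (v x), (N i j) (v j)⟫_ℂ
        = ∑ i, ∑ x, ⟪(N i x) (v x), (N i j) (v j)⟫_ℂ := fun j => Finset.sum_comm
    simp only [this]
    rw [Finset.sum_comm]
  rw [h, Complex.re_sum]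
  exact Finset.sum_nonneg fun l _ => inner_self_nonneg (𝕜 := ℂ)

/-- A self-adjoint operator matrix with nonnegative quadratic form is nonnegative. -/
lemma cstarMatrix_nonneg {k : ℕ} {M : CStarMatrix (Fin k) (Fin k) (H →L[ℂ] H)}
    (hsa : IsSelfAdjoint M)
    (hq : ∀ v : Fin k → H, 0 ≤ (∑ i, ∑ j, ⟪v i, M i j (v j)⟫_ℂ).re) : 0 ≤ M := by
  obtain ⟨P, hPsa, hPMP, hP3, hfin⟩ := exists_negPart hsa
  have key : ∀ v : Fin k → H, (∑ i, ∑ j, ⟪v i, (P * M * P) i j (v j)⟫_ℂ)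
      = ∑ i, ∑ j, ⟪∑ a, P i a (v a), M i j (∑ b, P j b (v b))⟫_ℂ := by
    intro v
    have hadj : ∀ i a, P i a = ContinuousLinearMap.adjoint (P a i) := by
      intro i a
      conv_lhs => rw [← hPsa]
      rfl
    simp only [CStarMatrix.mul_apply, sum_inner, inner_sum, map_sum, Finset.sum_mul,
      _root_.sum_apply, mul_apply_eq_comp]
    have e1 : ∀ i j b a, ⟪v i, P i a (M a b (P b j (v j)))⟫_ℂ
        = ⟪P a i (v i), M a b (P b j (v j))⟫_ℂ := by
      intro i j b a
      rw [hadj i a, ContinuousLinearMap.adjoint_inner_right]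
    simp only [e1]
    calc _ = ∑ i, ∑ a, ∑ j, ∑ b, ⟪P a i (v i), M a b (P b j (v j))⟫_ℂ := by
          refine Finset.sum_congr rfl fun i _ => ?_
          rw [Finset.sum_comm (s := Finset.univ (α := Fin k)) (t := Finset.univ (α := Fin k))
            (f := fun a j => ∑ b, ⟪P a i (v i), M a b (P b j (v j))⟫_ℂ)]
          refine Finset.sum_congr rfl fun j _ => ?_
          rw [Finset.sum_comm]
      _ = ∑ a, ∑ i, ∑ j, ∑ b, ⟪P a i (v i), M a b (P b j (v j))⟫_ℂ := Finset.sum_comm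
      _ = _ := by
          refine Finset.sum_congr rfl fun a _ => ?_
          have : ∀ i, ∑ j, ∑ b, ⟪P a i (v i), M a b (P b j (v j))⟫_ℂ
            = ∑ b, ∑ j, ⟪P a i (v i), M a b (P b j (v j))⟫_ℂ := fun i => Finset.sum_comm
          simp only [this]
          rw [Finset.sum_comm]
          refine Finset.sum_congr rfl fun b _ => ?_
          rw [Finset.sum_comm]
  have hzero : ∀ v : Fin k → H, (∑ i, ∑ j, ⟪v i, (P * P * P) i j (v j)⟫_ℂ).re = 0 := by
    intro v
    apply le_antisymm _ (re_sum_inner_nonneg hP3 v)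
    have h := hq (fun i => ∑ a, P i a (v a))
    rw [← key v, hPMP] at h
    simp only [CStarMatrix.neg_apply, _root_.neg_apply, inner_neg_right,
      Finset.sum_neg_distrib, Complex.neg_re] at h
    linarith
  have hP30 : P * P * P = 0 := by
    obtain ⟨N, hN⟩ := exists_star_mul_self hP3
    have hN0 : N = 0 := by
      ext l j w
      have h := hzero (Pi.single j w)
      have h2 : ∑ i, ∑ j', ⟪(Pi.single j w : Fin k → H) i,
            (P * P * P) i j' ((Pi.single j w : Fin k → H) j')⟫_ℂ
          = ⟪w, (P * P * P) j j w⟫_ℂ := by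
        rw [Finset.sum_eq_single j, Finset.sum_eq_single j]
        · simp
        · intro b _ hb; simp [Pi.single_eq_of_ne hb]
        · simp
        · intro b _ hb; simp [Pi.single_eq_of_ne hb]
        · simp
      rw [h2, hN] at h
      simp only [CStarMatrix.mul_apply, CStarMatrix.star_apply, inner_sum,
        _root_.sum_apply, mul_apply_eq_comp,
        ContinuousLinearMap.star_eq_adjoint, ContinuousLinearMap.adjoint_inner_right,
        Complex.re_sum] at h
      have h3 := (Finset.sum_eq_zero_iff_of_nonneg
        (fun l _ => inner_self_nonneg (𝕜 := ℂ) (x := N l j w))).mp h l (Finset.mem_univ l)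
      have h4 : ‖N l j w‖ ^ 2 = 0 := (inner_self_eq_norm_sq (𝕜 := ℂ) (N l j w)).symm.trans h3
      simpa using h4
    rw [hN, hN0]; simp
  exact hfin hP30

end Positivity

/-! ### Normality -/

section Normal

variable {K : Type*} [NormedAddCommGroup K] [InnerProductSpace ℂ K] [CompleteSpace K]

open Filter in
/-- Monotone convergence: an upward directed set of operators with a least upper bound converges
to that bound in the weak sense. -/
lemma tendsto_inner_of_isLUB {S : Set (K →L[ℂ] K)} (hne : S.Nonempty)
    (hdir : DirectedOn (· ≤ ·) S) {T : K →L[ℂ] K} (hT : IsLUB S T) (v : K) :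
    Tendsto (fun s : S => (⟪(T - s) v, v⟫_ℂ).re) atTop (𝓝 0) := by
  classical
  have hneS : Nonempty S := hne.to_subtype
  have : IsDirectedOrder S := ⟨fun a b => by
    obtain ⟨c, hc, hac, hbc⟩ := hdir a a.2 b b.2
    exact ⟨⟨c, hc⟩, hac, hbc⟩⟩
  obtain ⟨s₀⟩ := id hneS
  let U : Ultrafilter S := Ultrafilter.of atTop
  have hU : (U : Filter S) ≤ atTop := Ultrafilter.of_le atTop
  have hpos : ∀ s : S, 0 ≤ T - s := fun s => sub_nonneg.mpr (hT.1 s.2)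
  have hbd : ∀ s : S, s₀ ≤ s → ‖T - s‖ ≤ ‖T - s₀‖ := fun s hs =>
    CStarAlgebra.norm_le_norm_of_nonneg_of_le (hpos s) (sub_le_sub_left (show (s₀ : K →L[ℂ] K) ≤ s from hs) T)
  have hlim : ∀ φ ψ : K, ∃ z : ℂ, ‖z‖ ≤ ‖T - s₀‖ * ‖φ‖ * ‖ψ‖ ∧
      Tendsto (fun s : S => ⟪(T - s) φ, ψ⟫_ℂ) U (𝓝 z) := by
    intro φ ψ
    have hc : IsCompact (Metric.closedBall (0 : ℂ) (‖T - s₀‖ * ‖φ‖ * ‖ψ‖)) :=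
      isCompact_closedBall _ _
    obtain ⟨z, hz, hz'⟩ := hc.ultrafilter_le_nhds (U.map fun s : S => ⟪(T - s) φ, ψ⟫_ℂ) (by
      rw [le_principal_iff]
      have : ∀ᶠ s in (U : Filter S), s₀ ≤ s := hU (eventually_ge_atTop s₀)
      refine this.mono fun s hs => ?_
      show ⟪(T - s) φ, ψ⟫_ℂ ∈ Metric.closedBall (0 : ℂ) (‖T - s₀‖ * ‖φ‖ * ‖ψ‖)
      rw [mem_closedBall_zero_iff]
      refine (norm_inner_le_norm _ _).trans ?_
      gcongr
      exact ((T - (s : K →L[ℂ] K)).le_opNorm φ).trans (by gcongr; exact hbd s hs))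
    exact ⟨z, by simpa using hz, hz'⟩
  choose B hB hBlim using hlim
  let b : K →ₗ⋆[ℂ] K →ₗ[ℂ] ℂ := LinearMap.mk₂'ₛₗ (starRingEnd ℂ) (RingHom.id ℂ) B
    (fun x y z => tendsto_nhds_unique (hBlim _ _) (by
      simpa only [map_add, inner_add_left] using (hBlim x z).add (hBlim y z)))
    (fun c x y => tendsto_nhds_unique (hBlim _ _) (by
      simpa only [map_smul, inner_smul_left, smul_eq_mul] using (hBlim x y).const_mul
        (starRingEnd ℂ c)))
    (fun x y z => tendsto_nhds_unique (hBlim _ _) (by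
      simpa only [map_add, inner_add_right] using (hBlim x y).add (hBlim x z)))
    (fun c x y => tendsto_nhds_unique (hBlim _ _) (by
      simpa only [map_smul, inner_smul_right, smul_eq_mul, RingHom.id_apply] using
        (hBlim x y).const_mul c))
  let D : K →L[ℂ] K := InnerProductSpace.continuousLinearMapOfBilin (b.mkContinuous₂ _ hB)
  have hD : ∀ x y, ⟪D x, y⟫_ℂ = B x y := fun x y =>
    InnerProductSpace.continuousLinearMapOfBilin_apply _ x y
  have hanti : ∀ x, ∀ s t : S, s ≤ t →
      (⟪(T - t) x, x⟫_ℂ).re ≤ (⟪(T - s) x, x⟫_ℂ).re := by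
    intro x s t hst
    have h : (0 : K →L[ℂ] K) ≤ t - s := sub_nonneg.mpr hst
    have h2 := ((ContinuousLinearMap.nonneg_iff_isPositive _).mp h).re_inner_nonneg_left x
    simp only [_root_.sub_apply, inner_sub_left, Complex.sub_re, RCLike.re_to_complex] at h2 ⊢
    linarith
  have hre : ∀ x, Tendsto (fun s : S => (⟪(T - s) x, x⟫_ℂ).re) U (𝓝 (B x x).re) := fun x =>
    (Complex.continuous_re.tendsto _).comp (hBlim x x)
  have hDpos : D.IsPositive := by
    rw [ContinuousLinearMap.isPositive_iff_complex]
    intro x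
    rw [hD]
    have h0 : ∀ s : S, (⟪(T - s) x, x⟫_ℂ).im = 0 := fun s => by
      have := ((ContinuousLinearMap.isPositive_iff_complex _).mp
        ((ContinuousLinearMap.nonneg_iff_isPositive _).mp (hpos s)) x).1
      rw [← this]; simp
    have him : (B x x).im = 0 :=
      tendsto_nhds_unique ((Complex.continuous_im.tendsto _).comp (hBlim x x))
        (by simp only [Function.comp_def, h0]; exact tendsto_const_nhds)
    refine ⟨by apply Complex.ext <;> simp [him], ?_⟩
    exact ge_of_tendsto' (hre x) fun s =>
      ((ContinuousLinearMap.nonneg_iff_isPositive _).mp (hpos s)).re_inner_nonneg_left x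
  have hDle : ∀ s : S, D ≤ T - s := by
    intro s
    rw [ContinuousLinearMap.le_def, ContinuousLinearMap.isPositive_def]
    have hsym : IsSelfAdjoint ((T - s) - D) :=
      (IsSelfAdjoint.of_nonneg (hpos s)).sub hDpos.isSelfAdjoint
    refine ⟨ContinuousLinearMap.isSelfAdjoint_iff_isSymmetric.mp hsym, fun x => ?_⟩
    rw [ContinuousLinearMap.reApplyInnerSelf_apply, _root_.sub_apply, inner_sub_left, hD]
    have : (B x x).re ≤ (⟪(T - s) x, x⟫_ℂ).re :=
      le_of_tendsto (hre x) (hU ((eventually_ge_atTop s).mono fun t ht => hanti x s t ht))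
    rw [map_sub, RCLike.re_to_complex, RCLike.re_to_complex]
    exact sub_nonneg.mpr this
  have hD0 : D = 0 := by
    apply le_antisymm _ ((ContinuousLinearMap.nonneg_iff_isPositive _).mpr hDpos)
    have : T ≤ T - D := hT.2 fun s hs => by
      have := hDle ⟨s, hs⟩
      exact le_sub_comm.mp this
    simpa using this
  have hB0 : (B v v).re = 0 := by rw [← hD, hD0]; simp
  have h1 := hre v
  rw [hB0] at h1
  have hnn : ∀ s : S, 0 ≤ (⟪(T - s) v, v⟫_ℂ).re := fun s =>
    ((ContinuousLinearMap.nonneg_iff_isPositive _).mp (hpos s)).re_inner_nonneg_left v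
  rw [tendsto_order]
  refine ⟨fun a ha => Eventually.of_forall fun s => ha.trans_le (hnn s), fun ε hε => ?_⟩
  obtain ⟨s₁, hs₁⟩ := ((h1.eventually (gt_mem_nhds hε))).exists
  exact (eventually_ge_atTop s₁).mono fun s hs => (hanti v s₁ s hs).trans_lt hs₁

end Normal

/-! ### Channels -/

section Channel

variable {H K : Type*} [NormedAddCommGroup H] [InnerProductSpace ℂ H] [CompleteSpace H]
  [NormedAddCommGroup K] [InnerProductSpace ℂ K] [CompleteSpace K]

/-- A channel in the Heisenberg picture, with output space `K` and input space `H`: a normal unital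
completely positive map from `𝓛(K)` to `𝓛(H)`. Normality means that suprema of (bounded) upward
directed sets of operators, for the Loewner order, are preserved. -/
structure Channel (K H : Type*) [NormedAddCommGroup K] [InnerProductSpace ℂ K] [CompleteSpace K]
    [NormedAddCommGroup H] [InnerProductSpace ℂ H] [CompleteSpace H]
    extends CompletelyPositiveMap (K →L[ℂ] K) (H →L[ℂ] H) where
  map_one' : toFun 1 = 1
  normal' : ScottContinuous toFun

instance : CoeFun (Channel K H) fun _ => (K →L[ℂ] K) → (H →L[ℂ] H) :=
  ⟨fun Λ => Λ.toFun⟩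

/-- `Λ₁.PostProcessingOf Λ₂` is the relation `Λ₁ ≾ Λ₂`: one has `Λ₁ = Λ₂ ∘ ℰ` for some
channel `ℰ` between the output spaces. -/
def Channel.PostProcessingOf {K₁ K₂ : Type*}
    [NormedAddCommGroup K₁] [InnerProductSpace ℂ K₁] [CompleteSpace K₁]
    [NormedAddCommGroup K₂] [InnerProductSpace ℂ K₂] [CompleteSpace K₂]
    (Λ₁ : Channel K₁ H) (Λ₂ : Channel K₂ H) : Prop :=
  ∃ E : Channel K₁ K₂, ∀ C : K₁ →L[ℂ] K₁, Λ₁ C = Λ₂ (E C)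

variable {ι : Type*} {V : ι → H →L[ℂ] K}

lemma kraus_norm_sum_le (hV : ∀ ψ, HasSum (fun i => ‖V i ψ‖ ^ 2) (‖ψ‖ ^ 2)) (u : ι → K)
    (s : Finset ι) :
    ‖∑ i ∈ s, ContinuousLinearMap.adjoint (V i) (u i)‖ ≤ √(∑ i ∈ s, ‖u i‖ ^ 2) := by
  set w := ∑ i ∈ s, ContinuousLinearMap.adjoint (V i) (u i) with hw
  have h1 : ‖w‖ ^ 2 ≤ ‖w‖ * √(∑ i ∈ s, ‖u i‖ ^ 2) := by
    calc ‖w‖ ^ 2 = ‖⟪w, w⟫_ℂ‖ := by rw [inner_self_eq_norm_sq_to_K]; simp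
      _ = ‖∑ i ∈ s, ⟪V i w, u i⟫_ℂ‖ := by
          conv_lhs => rw [hw]
          rw [← hw, inner_sum]
          simp only [ContinuousLinearMap.adjoint_inner_right]
      _ ≤ ∑ i ∈ s, ‖V i w‖ * ‖u i‖ :=
          (norm_sum_le _ _).trans (Finset.sum_le_sum fun i _ => norm_inner_le_norm _ _)
      _ ≤ √(∑ i ∈ s, ‖V i w‖ ^ 2) * √(∑ i ∈ s, ‖u i‖ ^ 2) :=
          Real.sum_mul_le_sqrt_mul_sqrt _ _ _
      _ ≤ ‖w‖ * √(∑ i ∈ s, ‖u i‖ ^ 2) := by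
          gcongr
          rw [Real.sqrt_le_left (norm_nonneg _)]
          exact sum_le_hasSum _ (fun _ _ => by positivity) (hV w)
  rcases (norm_nonneg w).eq_or_lt with h0 | h0
  · rw [← h0]; positivity
  · nlinarith

lemma kraus_summable (hV : ∀ ψ, HasSum (fun i => ‖V i ψ‖ ^ 2) (‖ψ‖ ^ 2)) (C : K →L[ℂ] K) (ψ : H) :
    Summable fun i => ContinuousLinearMap.adjoint (V i) (C (V i ψ)) := by
  rw [summable_iff_vanishing_norm]
  intro ε hε
  have hs : Summable fun i => ‖C (V i ψ)‖ ^ 2 := by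
    refine Summable.of_nonneg_of_le (fun _ => by positivity) (fun i => ?_)
      ((hV ψ).summable.mul_left (‖C‖ ^ 2))
    rw [← mul_pow]
    gcongr
    exact C.le_opNorm _
  obtain ⟨s, hs⟩ := (summable_iff_vanishing_norm.mp hs) (ε ^ 2) (by positivity)
  refine ⟨s, fun t ht => (kraus_norm_sum_le hV _ t).trans_lt ?_⟩
  rw [Real.sqrt_lt' hε]
  exact (le_abs_self _).trans_lt (hs t ht)

/-- The operator `∑ i, (V i)† C (V i)`, where the series converges strongly, for a family of
operators with `∑ i, (V i)† (V i) = 1`. -/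
def krausSum (V : ι → H →L[ℂ] K) (hV : ∀ ψ, HasSum (fun i => ‖V i ψ‖ ^ 2) (‖ψ‖ ^ 2))
    (C : K →L[ℂ] K) : H →L[ℂ] H :=
  LinearMap.mkContinuous
    { toFun := fun ψ => ∑' i, ContinuousLinearMap.adjoint (V i) (C (V i ψ))
      map_add' := fun φ ψ => by
        simp only [map_add]
        exact (kraus_summable hV C φ).tsum_add (kraus_summable hV C ψ)
      map_smul' := fun c ψ => by
        simp only [map_smul, RingHom.id_apply]
        exact (kraus_summable hV C ψ).tsum_const_smul c }
    ‖C‖ (fun ψ => by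
      refine le_of_tendsto' (kraus_summable hV C ψ).hasSum.norm fun s =>
        (kraus_norm_sum_le hV _ s).trans ?_
      rw [Real.sqrt_le_left (by positivity), mul_pow]
      calc ∑ i ∈ s, ‖C (V i ψ)‖ ^ 2 ≤ ∑ i ∈ s, ‖C‖ ^ 2 * ‖V i ψ‖ ^ 2 :=
            Finset.sum_le_sum fun i _ => by
              rw [← mul_pow]
              gcongr
              exact C.le_opNorm _
        _ = ‖C‖ ^ 2 * ∑ i ∈ s, ‖V i ψ‖ ^ 2 := by rw [Finset.mul_sum]
        _ ≤ _ := by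
              gcongr
              exact sum_le_hasSum _ (fun _ _ => by positivity) (hV ψ))

lemma krausSum_hasSum (hV : ∀ ψ, HasSum (fun i => ‖V i ψ‖ ^ 2) (‖ψ‖ ^ 2)) (C : K →L[ℂ] K)
    (ψ : H) :
    HasSum (fun i => ContinuousLinearMap.adjoint (V i) (C (V i ψ))) (krausSum V hV C ψ) :=
  (kraus_summable hV C ψ).hasSum

lemma krausSum_inner (hV : ∀ ψ, HasSum (fun i => ‖V i ψ‖ ^ 2) (‖ψ‖ ^ 2)) (C : K →L[ℂ] K)
    (φ ψ : H) :
    HasSum (fun i => ⟪V i φ, C (V i ψ)⟫_ℂ) ⟪φ, krausSum V hV C ψ⟫_ℂ := by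
  have h := (krausSum_hasSum hV C ψ).mapL (innerSL ℂ φ)
  simpa only [innerSL_apply_apply, ContinuousLinearMap.adjoint_inner_right] using h

lemma krausSum_add (hV : ∀ ψ, HasSum (fun i => ‖V i ψ‖ ^ 2) (‖ψ‖ ^ 2)) (C D : K →L[ℂ] K) :
    krausSum V hV (C + D) = krausSum V hV C + krausSum V hV D := by
  ext ψ
  refine (krausSum_hasSum hV (C + D) ψ).unique ?_
  simpa using (krausSum_hasSum hV C ψ).add (krausSum_hasSum hV D ψ)

lemma krausSum_smul (hV : ∀ ψ, HasSum (fun i => ‖V i ψ‖ ^ 2) (‖ψ‖ ^ 2)) (c : ℂ)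
    (C : K →L[ℂ] K) : krausSum V hV (c • C) = c • krausSum V hV C := by
  ext ψ
  refine (krausSum_hasSum hV (c • C) ψ).unique ?_
  simpa using (krausSum_hasSum hV C ψ).const_smul c

lemma krausSum_one (hV : ∀ ψ, HasSum (fun i => ‖V i ψ‖ ^ 2) (‖ψ‖ ^ 2)) :
    krausSum V hV 1 = 1 := by
  have h : (krausSum V hV 1 : H →ₗ[ℂ] H) = (1 : H →L[ℂ] H) := by
    refine (ext_inner_map _ _).mp fun ψ => ?_
    rw [← inner_conj_symm]
    refine (congrArg _ ((krausSum_inner hV 1 ψ ψ).unique (a₂ := (‖ψ‖ : ℂ) ^ 2) ?_)).trans ?_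
    · have := (hV ψ).mapL Complex.ofRealCLM
      simpa [inner_self_eq_norm_sq_to_K] using this
    · simp [inner_self_eq_norm_sq_to_K]
  exact ContinuousLinearMap.coe_injective h

lemma krausSum_star (hV : ∀ ψ, HasSum (fun i => ‖V i ψ‖ ^ 2) (‖ψ‖ ^ 2)) (C : K →L[ℂ] K) :
    star (krausSum V hV C) = krausSum V hV (star C) := by
  ext ψ
  refine ext_inner_left ℂ fun φ => ?_
  rw [ContinuousLinearMap.star_eq_adjoint, ContinuousLinearMap.adjoint_inner_right,
    ← inner_conj_symm]
  refine ((Complex.hasSum_conj.mpr (by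
    simpa using krausSum_inner hV C ψ φ)).unique ?_)
  have := krausSum_inner hV (star C) φ ψ
  simpa [ContinuousLinearMap.star_eq_adjoint, ContinuousLinearMap.adjoint_inner_right] using this

lemma krausSum_cstarMatrix_nonneg (hV : ∀ ψ, HasSum (fun i => ‖V i ψ‖ ^ 2) (‖ψ‖ ^ 2)) (k : ℕ)
    (M : CStarMatrix (Fin k) (Fin k) (K →L[ℂ] K)) (hM : 0 ≤ M) :
    0 ≤ M.map (krausSum V hV) := by
  have hMsa : star M = M := (IsSelfAdjoint.of_nonneg hM).star_eq
  refine cstarMatrix_nonneg ?_ fun v => ?_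
  · show star _ = _
    ext i j : 2
    rw [CStarMatrix.star_apply, CStarMatrix.map_apply, CStarMatrix.map_apply, krausSum_star]
    congr 1
    conv_rhs => rw [← hMsa]
    rfl
  · have h : HasSum (fun a => (∑ i, ∑ j, ⟪V a (v i), M i j (V a (v j))⟫_ℂ))
        (∑ i, ∑ j, ⟪v i, (M.map (krausSum V hV)) i j (v j)⟫_ℂ) :=
      hasSum_sum fun i _ => hasSum_sum fun j _ => krausSum_inner hV (M i j) (v i) (v j)
    have h2 := h.mapL Complex.reCLM
    exact h2.nonneg fun a => re_sum_inner_nonneg hM fun i => V a (v i)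

lemma krausSum_nonneg (hV : ∀ ψ, HasSum (fun i => ‖V i ψ‖ ^ 2) (‖ψ‖ ^ 2)) {C : K →L[ℂ] K}
    (hC : 0 ≤ C) : 0 ≤ krausSum V hV C := by
  rw [ContinuousLinearMap.nonneg_iff_isPositive, ContinuousLinearMap.isPositive_def]
  refine ⟨ContinuousLinearMap.isSelfAdjoint_iff_isSymmetric.mp ?_, fun ψ => ?_⟩
  · show star _ = _
    rw [krausSum_star, (IsSelfAdjoint.of_nonneg hC).star_eq]
  · rw [ContinuousLinearMap.reApplyInnerSelf_apply, inner_re_symm]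
    exact ((krausSum_inner hV C ψ ψ).mapL Complex.reCLM).nonneg fun i =>
      ((ContinuousLinearMap.nonneg_iff_isPositive _).mp hC).re_inner_nonneg_right _

lemma krausSum_sub (hV : ∀ ψ, HasSum (fun i => ‖V i ψ‖ ^ 2) (‖ψ‖ ^ 2)) (C D : K →L[ℂ] K) :
    krausSum V hV (C - D) = krausSum V hV C - krausSum V hV D := by
  rw [eq_sub_iff_add_eq, ← krausSum_add, sub_add_cancel]

open Filter in
lemma krausSum_normal (hV : ∀ ψ, HasSum (fun i => ‖V i ψ‖ ^ 2) (‖ψ‖ ^ 2)) :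
    ScottContinuous (krausSum V hV) := by
  intro S hne hdir T hT
  have hne' : Nonempty S := hne.to_subtype
  have hdir' : IsDirectedOrder S := ⟨fun a b => by
    obtain ⟨c, hc, hac, hbc⟩ := hdir a a.2 b b.2
    exact ⟨⟨c, hc⟩, hac, hbc⟩⟩
  obtain ⟨s₀⟩ := id hne'
  have hpos : ∀ s : S, 0 ≤ T - s := fun s => sub_nonneg.mpr (hT.1 s.2)
  constructor
  · rintro _ ⟨s, hs, rfl⟩
    rw [← sub_nonneg, ← krausSum_sub]
    exact krausSum_nonneg hV (hpos ⟨s, hs⟩)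
  · intro U hU
    have hU' : ∀ s : S, 0 ≤ U - krausSum V hV s := fun s => sub_nonneg.mpr (hU ⟨s, s.2, rfl⟩)
    rw [ContinuousLinearMap.le_def, ContinuousLinearMap.isPositive_def]
    have he : ∀ s : S, U - krausSum V hV T
        = (U - krausSum V hV s) - krausSum V hV (T - s) := fun s => by
      rw [krausSum_sub]; abel
    refine ⟨ContinuousLinearMap.isSelfAdjoint_iff_isSymmetric.mp ?_, fun ψ => ?_⟩
    · rw [he s₀]
      exact (IsSelfAdjoint.of_nonneg (hU' s₀)).sub
        (IsSelfAdjoint.of_nonneg (krausSum_nonneg hV (hpos s₀)))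
    rw [ContinuousLinearMap.reApplyInnerSelf_apply]
    have hterm : ∀ s : S, HasSum (fun i => (⟪(T - s) (V i ψ), V i ψ⟫_ℂ).re)
        (⟪krausSum V hV (T - s) ψ, ψ⟫_ℂ).re := fun s => by
      have h := (krausSum_inner hV (T - s) ψ ψ).mapL Complex.reCLM
      simp only [Complex.reCLM_apply] at h
      have e : ∀ a b : K, (⟪a, b⟫_ℂ).re = (⟪b, a⟫_ℂ).re := fun a b => inner_re_symm (𝕜 := ℂ) a b
      have e' : ∀ a b : H, (⟪a, b⟫_ℂ).re = (⟪b, a⟫_ℂ).re := fun a b => inner_re_symm (𝕜 := ℂ) a b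
      rw [e']
      simp only [e _ (V _ ψ)]
      exact h
    have hlim : Tendsto (fun s : S => (⟪krausSum V hV (T - s) ψ, ψ⟫_ℂ).re) atTop (𝓝 0) := by
      have h := tendsto_tsum_of_dominated_convergence (𝓕 := (atTop : Filter S))
        (f := fun (s : S) i => (⟪(T - s) (V i ψ), V i ψ⟫_ℂ).re) (g := fun _ => (0 : ℝ))
        (bound := fun i => (⟪(T - s₀) (V i ψ), V i ψ⟫_ℂ).re) (hterm s₀).summable
        (fun i => tendsto_inner_of_isLUB hne hdir hT (V i ψ))
        ((eventually_ge_atTop s₀).mono fun s hs i => by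
          have h0 := ((ContinuousLinearMap.nonneg_iff_isPositive _).mp
            (hpos s)).re_inner_nonneg_left (V i ψ)
          have h1 := ((ContinuousLinearMap.nonneg_iff_isPositive _).mp
            (sub_nonneg.mpr (show (s₀ : K →L[ℂ] K) ≤ s from hs))).re_inner_nonneg_left (V i ψ)
          refine (Real.norm_of_nonneg h0).trans_le ?_
          simp only [_root_.sub_apply, inner_sub_left, Complex.sub_re, map_sub,
            RCLike.re_to_complex] at h1 ⊢
          linarith)
      simpa only [(hterm _).tsum_eq, tsum_zero] using h
    have hle : ∀ s : S, -(⟪krausSum V hV (T - s) ψ, ψ⟫_ℂ).re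
        ≤ (⟪(U - krausSum V hV T) ψ, ψ⟫_ℂ).re := fun s => by
      have h := ((ContinuousLinearMap.nonneg_iff_isPositive _).mp (hU' s)).re_inner_nonneg_left ψ
      rw [he s, _root_.sub_apply (U - _), inner_sub_left, Complex.sub_re]
      simp only [RCLike.re_to_complex] at h
      linarith
    exact (neg_zero (G := ℝ)).symm.le.trans (le_of_tendsto' hlim.neg hle)

/-- The channel `C ↦ ∑ i, (V i)† C (V i)`, for operators with `∑ i, (V i)† (V i) = 1`. -/
def Channel.ofKraus (V : ι → H →L[ℂ] K) (hV : ∀ ψ, HasSum (fun i => ‖V i ψ‖ ^ 2) (‖ψ‖ ^ 2)) :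
    Channel K H where
  toFun := krausSum V hV
  map_add' := krausSum_add hV
  map_smul' := krausSum_smul hV
  map_cstarMatrix_nonneg' := krausSum_cstarMatrix_nonneg hV
  map_one' := krausSum_one hV
  normal' := krausSum_normal hV

end Channel

/-! ### Observables -/

section Observable

open ContinuousLinearMapWOT

variable {H K : Type*} [NormedAddCommGroup H] [InnerProductSpace ℂ H] [CompleteSpace H]
  [NormedAddCommGroup K] [InnerProductSpace ℂ K] [CompleteSpace K]

/-- `∑ i, f i = T` in the weak operator topology. -/
def HasWOTSum {ι : Type*} (f : ι → H →L[ℂ] H) (T : H →L[ℂ] H) : Prop :=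
  HasSum (fun i => (ofCLM (f i) : H →WOT[ℂ] H)) (ofCLM T)

lemma hasWOTSum_iff {ι : Type*} {f : ι → H →L[ℂ] H} {T : H →L[ℂ] H} :
    HasWOTSum f T ↔ ∀ φ ψ : H, HasSum (fun i => ⟪φ, f i ψ⟫_ℂ) ⟪φ, T ψ⟫_ℂ := by
  unfold HasWOTSum HasSum
  rw [tendsto_iff_forall_inner_apply_tendsto, forall_comm]
  have h : ∀ (s : Finset ι) (φ ψ : H), ⟪φ, (∑ i ∈ s, (ofCLM (f i) : H →WOT[ℂ] H)) ψ⟫_ℂ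
      = ∑ i ∈ s, ⟪φ, f i ψ⟫_ℂ := by
    intro s φ ψ
    induction s using Finset.cons_induction with
    | empty => simp
    | cons a s ha ih => rw [Finset.sum_cons, Finset.sum_cons, ContinuousLinearMapWOT.add_apply, inner_add_right, ih]; rfl
  simp only [h]
  rfl

/-- A quantum observable on `H` with outcomes in `ℕ`: positive operators that sum to the
identity. -/
structure Observable (H : Type*) [NormedAddCommGroup H] [InnerProductSpace ℂ H]
    [CompleteSpace H] where
  effect : ℕ → H →L[ℂ] H
  isPositive : ∀ x, (effect x).IsPositive
  hasSum_one : HasWOTSum effect 1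

/-- A stochastic matrix `(M x y)` indexed by `ℕ`: nonnegative entries, all columns sum to one. -/
structure IsStochasticMatrix (M : ℕ → ℕ → ℝ) : Prop where
  nonneg : ∀ x y, 0 ≤ M x y
  hasSum_one : ∀ y, HasSum (fun x => M x y) 1

/-- `A.SmearingOf B` is the relation `A ≼ B`: one has `A(x) = ∑ y, M x y • B(y)` for some
stochastic matrix `M`. -/
def Observable.SmearingOf (A B : Observable H) : Prop :=
  ∃ M : ℕ → ℕ → ℝ, IsStochasticMatrix M ∧
    ∀ x, HasWOTSum (fun y => (M x y : ℂ) • B.effect y) (A.effect x)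

/-- A Naimark dilation of `A` on `K`: an isometry `J : H → K` and a projection valued measure
`Â` on `K` with `J† Â(x) J = A(x)` for every outcome `x`. -/
structure NaimarkDilation (A : Observable H) (K : Type*) [NormedAddCommGroup K]
    [InnerProductSpace ℂ K] [CompleteSpace K] where
  isometry : H →ₗᵢ[ℂ] K
  pvm : Observable K
  isStarProjection : ∀ x, IsStarProjection (pvm.effect x)
  dilates : ∀ x, ContinuousLinearMap.adjoint isometry.toContinuousLinearMap ∘L pvm.effect x ∘L
    isometry.toContinuousLinearMap = A.effect x

lemma NaimarkDilation.hasSum_norm_sq {A : Observable H} (D : NaimarkDilation A K) (ψ : H) :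
    HasSum (fun x => ‖(D.pvm.effect x ∘L D.isometry.toContinuousLinearMap) ψ‖ ^ 2)
      (‖ψ‖ ^ 2) := by
  have h := (hasWOTSum_iff.mp D.pvm.hasSum_one (D.isometry ψ) (D.isometry ψ)).mapL Complex.reCLM
  have h1 : ∀ x, ‖(D.pvm.effect x ∘L D.isometry.toContinuousLinearMap) ψ‖ ^ 2
      = (⟪D.isometry ψ, D.pvm.effect x (D.isometry ψ)⟫_ℂ).re := by
    intro x
    have e := (D.isStarProjection x).isIdempotentElem
    have a := (D.isStarProjection x).isSelfAdjoint.star_eq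
    rw [← inner_self_eq_norm_sq (𝕜 := ℂ)]
    show (⟪D.pvm.effect x (D.isometry ψ), D.pvm.effect x (D.isometry ψ)⟫_ℂ).re = _
    rw [← ContinuousLinearMap.adjoint_inner_right, ← ContinuousLinearMap.star_eq_adjoint, a,
      ← mul_apply_eq_comp, e.eq]
  have h2 : (⟪D.isometry ψ, (1 : K →L[ℂ] K) (D.isometry ψ)⟫_ℂ).re = ‖ψ‖ ^ 2 := by
    rw [← D.isometry.norm_map ψ, ← inner_self_eq_norm_sq (𝕜 := ℂ)]
    rfl
  simp only [h1, ← h2]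
  exact h

/-- The least disturbing channel `C ↦ ∑ x, J† Â(x) C Â(x) J` of the observable `A`, built from the
Naimark dilation `(K, Â, J)` of `A`; note that `(Â(x) J)† = J† Â(x)`. -/
def NaimarkDilation.leastDisturbingChannel {A : Observable H} (D : NaimarkDilation A K) :
    Channel K H :=
  Channel.ofKraus (fun x => D.pvm.effect x ∘L D.isometry.toContinuousLinearMap) D.hasSum_norm_sq

lemma NaimarkDilation.hasSum_leastDisturbingChannel {A : Observable H} (D : NaimarkDilation A K)
    (C : K →L[ℂ] K) :
    HasWOTSum (fun x => ContinuousLinearMap.adjoint D.isometry.toContinuousLinearMap ∘L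
      D.pvm.effect x ∘L C ∘L D.pvm.effect x ∘L D.isometry.toContinuousLinearMap)
      (D.leastDisturbingChannel C) := by
  rw [hasWOTSum_iff]
  intro φ ψ
  have h := krausSum_inner D.hasSum_norm_sq C φ ψ
  refine h.congr_fun fun x => ?_
  have a := (D.isStarProjection x).isSelfAdjoint.star_eq
  rw [ContinuousLinearMap.star_eq_adjoint] at a
  simp only [ContinuousLinearMap.comp_apply, ContinuousLinearMap.adjoint_inner_right]
  rw [← ContinuousLinearMap.adjoint_inner_left, a]

end Observable

end QuantumMeasurement

end

/-! Write `K_y = B̂(y) J_B` and `L_x = Â(x) J_A` for the Kraus operators of the two channels, so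
that `K_y† K_y = B(y)` and `L_x† L_x = A(x)`.

Suppose `Λ_B = Λ_A ∘ ℰ`. Compressing the argument by `B̂(y)` isolates one Kraus operator: `Λ_B(B̂(y)
C B̂(y)) = K_y† C K_y`. The same map is the sum over `x` of the positive maps `C ↦ L_x† ℰ(B̂(y) C
B̂(y)) L_x`. A positive map dominated by a map with a single Kraus operator is proportional to it
(`re_inner_map_one_mul_comm`); at `C = 1` this gives `L_x† ℰ(B̂(y)) L_x = M x y • B(y)`. Summing
over `x` shows that the columns of `M` sum to one, and summing over `y` gives `A(x)`, since `ℰ(1) =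
1` (`hasSum_operation_effect`).

Conversely, `A(x) = ∑ y, M x y • B(y)` says that `‖L_x φ‖² = ∑ y, ‖√(M x y) K_y φ‖²`. Hence `L_x φ ↦
(√(M x y) K_y φ)_y` is a well-defined isometry on the range of `L_x`. Its components, completed on
the orthogonal complement, are Kraus operators of a channel (`exists_kraus_extension`). Measuring
`Â` and applying the channel that belongs to the outcome `x` defines `ℰ`. In `Λ_A(ℰ(C))` the weights
`M x y` sum to one over `x`, which leaves `∑ y, K_y† C K_y = Λ_B(C)`. -/

namespace QuantumMeasurement

open ContinuousLinearMap Filter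

/-! ### Positive maps dominated by a map with one Kraus operator -/

section PureMaps

/-- A nonnegative function with the parallelogram law and quadratic homogeneity that is dominated
by `|ℓ|²` for a linear functional `ℓ` is proportional to `|ℓ|²`. -/
lemma mul_norm_sq_comm_of_le_norm_sq {V : Type*} [AddCommGroup V] [Module ℂ V] {q : V → ℝ}
    (hpar : ∀ u v, q (u + v) + q (u - v) = 2 * q u + 2 * q v)
    (hsmul : ∀ (c : ℂ) v, q (c • v) = ‖c‖ ^ 2 * q v) (hnn : ∀ v, 0 ≤ q v)
    (ℓ : V →ₗ[ℂ] ℂ) (hle : ∀ v, q v ≤ ‖ℓ v‖ ^ 2) (u v : V) :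
    q u * ‖ℓ v‖ ^ 2 = q v * ‖ℓ u‖ ^ 2 := by
  -- Since `q η = 0`, the parallelogram law makes the second differences of `n ↦ q (w + n • η)`
  -- vanish. This sequence is therefore affine in `n`; as it stays between `0` and `‖ℓ w‖ ^ 2`, it
  -- is constant.
  have hker : ∀ w η, ℓ η = 0 → q (w + η) = q w := by
    intro w η hη
    have hη0 : q η = 0 := le_antisymm (by simpa [hη] using hle η) (hnn η)
    have hstep : ∀ n : ℕ, q (w + ((n + 1 : ℕ) : ℂ) • η) - q (w + (n : ℂ) • η)
        = q (w + η) - q w := by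
      intro n
      induction n with
      | zero => simp
      | succ n ih =>
        rw [← ih]
        have h := hpar (w + ((n + 1 : ℕ) : ℂ) • η) η
        have e1 : w + ((n + 1 : ℕ) : ℂ) • η + η = w + ((n + 1 + 1 : ℕ) : ℂ) • η := by
          push_cast; module
        have e2 : w + ((n + 1 : ℕ) : ℂ) • η - η = w + (n : ℂ) • η := by
          push_cast; module
        rw [e1, e2, hη0] at h
        linarith
    have hlin : ∀ n : ℕ, q (w + (n : ℂ) • η) = q w + n * (q (w + η) - q w) := by
      intro n
      induction n with
      | zero => simp
      | succ n ih =>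
        have := hstep n
        push_cast at this ⊢
        linarith
    have hb : ∀ n : ℕ, (n : ℝ) * |q (w + η) - q w| ≤ ‖ℓ w‖ ^ 2 := by
      intro n
      have h1 := hle (w + (n : ℂ) • η)
      have h2 := hle w
      have h3 := hnn (w + (n : ℂ) • η)
      have h4 := hnn w
      rw [hlin n] at h1 h3
      simp only [map_add, map_smul, hη, smul_zero, add_zero] at h1
      rw [← Nat.abs_cast n, ← abs_mul, abs_le]
      constructor <;> linarith
    by_contra hne
    have hpos : 0 < |q (w + η) - q w| := abs_pos.mpr (sub_ne_zero.mpr hne)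
    obtain ⟨n, hn⟩ := exists_nat_gt (‖ℓ w‖ ^ 2 / |q (w + η) - q w|)
    rw [div_lt_iff₀ hpos] at hn
    exact absurd (hb n) (not_le.mpr hn)
  -- The vectors `ℓ v • u` and `ℓ u • v` differ by an element of the kernel of `ℓ`.
  have h := hker (ℓ u • v) (ℓ v • u - ℓ u • v) (by simp [mul_comm])
  rw [add_sub_cancel, hsmul, hsmul] at h
  linarith

variable {H K : Type*} [NormedAddCommGroup H] [InnerProductSpace ℂ H]
  [NormedAddCommGroup K] [InnerProductSpace ℂ K]

lemma rankOne_self_nonneg (a : K) : 0 ≤ InnerProductSpace.rankOne ℂ a a :=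
  (ContinuousLinearMap.nonneg_iff_isPositive _).mpr (InnerProductSpace.isPositive_rankOne_self a)

lemma re_inner_rankOne_self (a ξ : K) :
    (⟪ξ, InnerProductSpace.rankOne ℂ a a ξ⟫_ℂ).re = ‖⟪a, ξ⟫_ℂ‖ ^ 2 := by
  rw [InnerProductSpace.rankOne_apply, inner_smul_right, ← inner_conj_symm ξ a,
    Complex.mul_conj, Complex.ofReal_re, Complex.normSq_eq_norm_sq]

lemma exists_inner_ne_zero {u v : K} (hu : u ≠ 0) (hv : v ≠ 0) :
    ∃ a : K, ⟪a, u⟫_ℂ ≠ 0 ∧ ⟪a, v⟫_ℂ ≠ 0 := by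
  by_cases h : ⟪u, v⟫_ℂ = 0
  · refine ⟨u + v, ?_, ?_⟩
    · rw [inner_add_left, inner_eq_zero_symm.mp h, add_zero]
      exact inner_self_ne_zero.mpr hu
    · rw [inner_add_left, h, zero_add]
      exact inner_self_ne_zero.mpr hv
  · exact ⟨u, inner_self_ne_zero.mpr hu, h⟩

variable [CompleteSpace K]

lemma nonneg_iff_re_inner {T : K →L[ℂ] K} (hT : IsSelfAdjoint T) :
    0 ≤ T ↔ ∀ ξ, 0 ≤ (⟪ξ, T ξ⟫_ℂ).re := by
  rw [ContinuousLinearMap.nonneg_iff_isPositive]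
  refine ⟨fun h ξ => h.re_inner_nonneg_right ξ, fun h => ?_⟩
  rw [ContinuousLinearMap.isPositive_def]
  refine ⟨ContinuousLinearMap.isSelfAdjoint_iff_isSymmetric.mp hT, fun ξ => ?_⟩
  rw [ContinuousLinearMap.reApplyInnerSelf_apply, inner_re_symm]
  exact h ξ

lemma rankOne_self_le (a : K) :
    0 ≤ ((‖a‖ ^ 2 : ℝ) : ℂ) • (1 : K →L[ℂ] K) - InnerProductSpace.rankOne ℂ a a := by
  have hsa : IsSelfAdjoint (((‖a‖ ^ 2 : ℝ) : ℂ) • (1 : K →L[ℂ] K)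
      - InnerProductSpace.rankOne ℂ a a) := by
    refine IsSelfAdjoint.sub ?_ (IsSelfAdjoint.of_nonneg (rankOne_self_nonneg a))
    exact IsSelfAdjoint.smul (Complex.conj_ofReal _) (IsSelfAdjoint.one _)
  rw [nonneg_iff_re_inner hsa]
  intro ξ
  rw [_root_.sub_apply, inner_sub_right, Complex.sub_re, re_inner_rankOne_self,
    _root_.smul_apply, inner_smul_right, Complex.re_ofReal_mul, one_apply_eq_self]
  have h := inner_self_eq_norm_sq (𝕜 := ℂ) ξ
  rw [RCLike.re_to_complex] at h
  rw [h, sub_nonneg, ← mul_pow]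
  gcongr
  exact norm_inner_le_norm _ _

/-- A positive linear map below `C ↦ W† C W` is proportional to it; here at `C = 1`. -/
lemma re_inner_map_one_mul_comm {Φ : (K →L[ℂ] K) →ₗ[ℂ] (H →L[ℂ] H)} {W : H →L[ℂ] K}
    (hnn : ∀ C, 0 ≤ C → ∀ φ, 0 ≤ (⟪φ, Φ C φ⟫_ℂ).re)
    (hle : ∀ C, 0 ≤ C → ∀ φ, (⟪φ, Φ C φ⟫_ℂ).re ≤ (⟪W φ, C (W φ)⟫_ℂ).re) (φ ψ : H) :
    (⟪φ, Φ 1 φ⟫_ℂ).re * ‖W ψ‖ ^ 2 = (⟪ψ, Φ 1 ψ⟫_ℂ).re * ‖W φ‖ ^ 2 := by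
  -- `F` is a quadratic form in each variable separately, and it is bounded by `‖⟪a, W φ⟫‖ ^ 2`, the
  -- squared modulus of a functional antilinear in `a` and linear in `φ`. The scalar lemma thus
  -- applies in `φ` (`hvec`) and, after conjugating the functional, in `a` (`hop`).
  set F : K → H → ℝ := fun a φ => (⟪φ, Φ (InnerProductSpace.rankOne ℂ a a) φ⟫_ℂ).re with hF
  have hF0 : ∀ a φ, 0 ≤ F a φ := fun a φ => hnn _ (rankOne_self_nonneg a) φ
  have hF1 : ∀ a φ, F a φ ≤ ‖⟪a, W φ⟫_ℂ‖ ^ 2 := fun a φ =>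
    (hle _ (rankOne_self_nonneg a) φ).trans_eq (re_inner_rankOne_self a (W φ))
  have hvec : ∀ a φ ψ, F a φ * ‖⟪a, W ψ⟫_ℂ‖ ^ 2 = F a ψ * ‖⟪a, W φ⟫_ℂ‖ ^ 2 := by
    intro a
    refine mul_norm_sq_comm_of_le_norm_sq (q := F a) (fun u v => ?_) (fun c v => ?_) (hF0 a)
      ((innerSL ℂ a).toLinearMap ∘ₗ W.toLinearMap) (hF1 a)
    · simp only [hF, map_add, map_sub, inner_add_left, inner_add_right, inner_sub_left,
        inner_sub_right, Complex.add_re, Complex.sub_re]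
      ring
    · simp only [hF, map_smul, inner_smul_left, inner_smul_right]
      rw [← mul_assoc, Complex.mul_conj', ← Complex.ofReal_pow, Complex.re_ofReal_mul]
  have hop : ∀ φ a b, F a φ * ‖⟪b, W φ⟫_ℂ‖ ^ 2 = F b φ * ‖⟪a, W φ⟫_ℂ‖ ^ 2 := by
    intro φ a b
    have h := mul_norm_sq_comm_of_le_norm_sq (q := fun a => F a φ) (fun u v => ?_) (fun c v => ?_)
      (fun a => hF0 a φ) (innerSL ℂ (W φ)).toLinearMap
      (fun a => by simpa [norm_inner_symm (W φ) a] using hF1 a φ) a b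
    · simpa [norm_inner_symm (W φ)] using h
    · simp only [hF, map_add, map_sub, _root_.add_apply, _root_.sub_apply, inner_add_right,
        inner_sub_right, Complex.add_re, Complex.sub_re]
      ring
    · simp only [hF, map_smul, map_smulₛₗ, _root_.smul_apply, inner_smul_right]
      rw [← mul_assoc, Complex.conj_mul', ← Complex.ofReal_pow, Complex.re_ofReal_mul]
  -- The positive operator `‖W φ‖² - |W φ⟩⟨W φ|` has expectation zero at `W φ`, so domination forces
  -- its image under `Φ` to have expectation zero at `φ`. This relates `Φ 1` to a rank-one operator
  -- without expanding `1` in a basis, which would call for normality of `Φ`.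
  have hone : ∀ φ, (⟪φ, Φ 1 φ⟫_ℂ).re * ‖W φ‖ ^ 2 = F (W φ) φ := by
    intro φ
    have h0 := hnn _ (rankOne_self_le (W φ)) φ
    have h1 := hle _ (rankOne_self_le (W φ)) φ
    rw [_root_.sub_apply, inner_sub_right, Complex.sub_re, re_inner_rankOne_self,
      _root_.smul_apply, inner_smul_right, Complex.re_ofReal_mul, one_apply_eq_self] at h1
    have h2 : ‖⟪W φ, W φ⟫_ℂ‖ = ‖W φ‖ ^ 2 := by
      rw [inner_self_eq_norm_sq_to_K]; simp
    have h3 : (⟪W φ, W φ⟫_ℂ).re = ‖W φ‖ ^ 2 := inner_self_eq_norm_sq (𝕜 := ℂ) (W φ)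
    rw [h2, h3] at h1
    rw [map_sub, map_smul, _root_.sub_apply, inner_sub_right, Complex.sub_re,
      _root_.smul_apply, inner_smul_right, Complex.re_ofReal_mul] at h0 h1
    simp only [hF]
    nlinarith
  have hzero : ∀ φ, W φ = 0 → (⟪φ, Φ 1 φ⟫_ℂ).re = 0 := fun φ h =>
    le_antisymm (by simpa [h] using hle 1 zero_le_one φ) (hnn 1 zero_le_one φ)
  by_cases hφ : W φ = 0
  · rw [hzero φ hφ, hφ]; simp
  by_cases hψ : W ψ = 0
  · rw [hzero ψ hψ, hψ]; simp
  -- A common `a` serves as intermediary: `key` compares `Φ 1` with `F a` at each vector, and `hvec`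
  -- compares `F a` at the two vectors.
  obtain ⟨a, ha, hb⟩ := exists_inner_ne_zero hφ hψ
  have key : ∀ φ, W φ ≠ 0 →
      (⟪φ, Φ 1 φ⟫_ℂ).re * ‖⟪a, W φ⟫_ℂ‖ ^ 2 = F a φ * ‖W φ‖ ^ 2 := by
    intro φ hφ
    have h1 := hop φ (W φ) a
    rw [← hone φ] at h1
    have h2 : ‖⟪W φ, W φ⟫_ℂ‖ = ‖W φ‖ ^ 2 := by
      rw [inner_self_eq_norm_sq_to_K]; simp
    rw [h2] at h1
    have h3 : ‖W φ‖ ^ 2 ≠ 0 := by simpa using hφ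
    refine mul_right_cancel₀ h3 ?_
    linear_combination h1
  have hc : ‖⟪a, W φ⟫_ℂ‖ ^ 2 * ‖⟪a, W ψ⟫_ℂ‖ ^ 2 ≠ 0 := by simp [ha, hb]
  refine mul_right_cancel₀ hc ?_
  linear_combination (‖W ψ‖ ^ 2 * ‖⟪a, W ψ⟫_ℂ‖ ^ 2) * key φ hφ
    - (‖W φ‖ ^ 2 * ‖⟪a, W φ⟫_ℂ‖ ^ 2) * key ψ hψ + (‖W φ‖ ^ 2 * ‖W ψ‖ ^ 2) * hvec a φ ψ

end PureMaps

/-! ### Weak sums, projection valued measures and conjugation -/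

section Effects

variable {H K : Type*} [NormedAddCommGroup H] [InnerProductSpace ℂ H] [CompleteSpace H]
  [NormedAddCommGroup K] [InnerProductSpace ℂ K] [CompleteSpace K]

/-- Weak convergence of a series of self-adjoint operators can be tested on quadratic forms. -/
lemma hasWOTSum_of_re_inner {ι : Type*} {f : ι → H →L[ℂ] H} {T : H →L[ℂ] H}
    (hf : ∀ i, IsSelfAdjoint (f i)) (hT : IsSelfAdjoint T)
    (h : ∀ φ, HasSum (fun i => (⟪φ, f i φ⟫_ℂ).re) (⟪φ, T φ⟫_ℂ).re) : HasWOTSum f T := by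
  have hre : ∀ S : H →L[ℂ] H, IsSelfAdjoint S → ∀ φ, (((⟪φ, S φ⟫_ℂ).re : ℝ) : ℂ) = ⟪S φ, φ⟫_ℂ := by
    intro S hS φ
    have hs := ContinuousLinearMap.isSelfAdjoint_iff_isSymmetric.mp hS
    have e : ⟪φ, S φ⟫_ℂ = ⟪S φ, φ⟫_ℂ := (hs φ φ).symm
    rw [e]
    exact hs.coe_re_inner_apply_self φ
  have hc : ∀ φ, HasSum (fun i => ⟪f i φ, φ⟫_ℂ) ⟪T φ, φ⟫_ℂ := fun φ => by
    have := (h φ).mapL Complex.ofRealCLM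
    simpa only [Complex.ofRealCLM_apply, hre _ (hf _), hre _ hT] using this
  rw [hasWOTSum_iff]
  intro φ ψ
  have hsym : ∀ S : H →L[ℂ] H, IsSelfAdjoint S → ⟪φ, S ψ⟫_ℂ = (⟪S (φ + ψ), φ + ψ⟫_ℂ
      - ⟪S (φ - ψ), φ - ψ⟫_ℂ - Complex.I * ⟪S (φ + Complex.I • ψ), φ + Complex.I • ψ⟫_ℂ
      + Complex.I * ⟪S (φ - Complex.I • ψ), φ - Complex.I • ψ⟫_ℂ) / 4 := by
    intro S hS
    have hs := ContinuousLinearMap.isSelfAdjoint_iff_isSymmetric.mp hS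
    have e : ⟪φ, S ψ⟫_ℂ = ⟪S φ, ψ⟫_ℂ := (hs φ ψ).symm
    rw [e]
    exact inner_map_polarization' (S : H →ₗ[ℂ] H) φ ψ
  simp only [hsym _ (hf _), hsym _ hT]
  exact ((((hc _).sub (hc _)).sub ((hc _).mul_left _)).add ((hc _).mul_left _)).div_const _

lemma re_inner_isStarProjection {P : K →L[ℂ] K} (hP : IsStarProjection P) (ξ : K) :
    (⟪ξ, P ξ⟫_ℂ).re = ‖P ξ‖ ^ 2 := by
  have e := hP.isIdempotentElem
  have a := hP.isSelfAdjoint.star_eq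
  rw [← inner_self_eq_norm_sq (𝕜 := ℂ), RCLike.re_to_complex, ← adjoint_inner_right,
    ← star_eq_adjoint, a, ← mul_apply_eq_comp, e.eq]

lemma Observable.hasSum_norm_sq_of_isStarProjection (P : Observable K)
    (hP : ∀ x, IsStarProjection (P.effect x)) (ξ : K) :
    HasSum (fun x => ‖P.effect x ξ‖ ^ 2) (‖ξ‖ ^ 2) := by
  have h := (hasWOTSum_iff.mp P.hasSum_one ξ ξ).mapL Complex.reCLM
  have h1 : (⟪ξ, ξ⟫_ℂ).re = ‖ξ‖ ^ 2 := inner_self_eq_norm_sq (𝕜 := ℂ) ξ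
  simpa only [Complex.reCLM_apply, re_inner_isStarProjection (hP _), one_apply_eq_self, h1] using h

/-- The projections of a projection valued measure are mutually orthogonal. -/
lemma Observable.effect_apply_effect_of_ne (P : Observable K)
    (hP : ∀ x, IsStarProjection (P.effect x)) {x y : ℕ} (hxy : x ≠ y) (ξ : K) :
    P.effect x (P.effect y ξ) = 0 := by
  -- At the vector `P(y) ξ` the term of index `y` already exhausts the total `‖P(y) ξ‖ ^ 2`.
  have h := sum_le_hasSum {x, y} (fun _ _ => by positivity)
    (P.hasSum_norm_sq_of_isStarProjection hP (P.effect y ξ))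
  rw [Finset.sum_pair hxy, ← mul_apply_eq_comp (P.effect y), (hP y).isIdempotentElem.eq] at h
  have h2 : ‖P.effect x (P.effect y ξ)‖ ^ 2 = 0 := le_antisymm (by linarith) (by positivity)
  simpa using h2

lemma Observable.effect_apply_effect_self (P : Observable K)
    (hP : ∀ x, IsStarProjection (P.effect x)) (x : ℕ) (ξ : K) :
    P.effect x (P.effect x ξ) = P.effect x ξ := by
  rw [← mul_apply_eq_comp (P.effect x), (hP x).isIdempotentElem.eq]

lemma Observable.one_sub_sum_effect_nonneg (P : Observable K) (s : Finset ℕ) :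
    0 ≤ 1 - ∑ y ∈ s, P.effect y := by
  have hsa : IsSelfAdjoint (1 - ∑ y ∈ s, P.effect y) :=
    (IsSelfAdjoint.one _).sub (isSelfAdjoint_sum s fun y _ => (P.isPositive y).isSelfAdjoint)
  rw [nonneg_iff_re_inner hsa]
  intro ξ
  have h := (hasWOTSum_iff.mp P.hasSum_one ξ ξ).mapL Complex.reCLM
  simp only [Complex.reCLM_apply] at h
  rw [_root_.sub_apply, inner_sub_right, Complex.sub_re, sub_nonneg, _root_.sum_apply, inner_sum,
    Complex.re_sum]
  exact sum_le_hasSum s (fun y _ => (P.isPositive y).re_inner_nonneg_right ξ) h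

/-- The map `C ↦ T† C T`. -/
noncomputable def conjMap (T : H →L[ℂ] K) : (K →L[ℂ] K) →ₗ[ℂ] (H →L[ℂ] H) where
  toFun C := adjoint T ∘L C ∘L T
  map_add' C D := by ext; simp
  map_smul' c C := by ext; simp

lemma inner_conjMap (T : H →L[ℂ] K) (C : K →L[ℂ] K) (φ ψ : H) :
    ⟪φ, conjMap T C ψ⟫_ℂ = ⟪T φ, C (T ψ)⟫_ℂ := by
  simp [conjMap, adjoint_inner_right]

lemma conjMap_nonneg (T : H →L[ℂ] K) {C : K →L[ℂ] K} (hC : 0 ≤ C) : 0 ≤ conjMap T C := by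
  rw [ContinuousLinearMap.nonneg_iff_isPositive] at hC ⊢
  exact hC.adjoint_conj T

end Effects

/-! ### Kraus operators of the least disturbing channel -/

section Dilation

variable {H K : Type*} [NormedAddCommGroup H] [InnerProductSpace ℂ H] [CompleteSpace H]
  [NormedAddCommGroup K] [InnerProductSpace ℂ K] [CompleteSpace K] {A : Observable H}

/-- The Kraus operator `Â(x) J` of the least disturbing channel. -/
noncomputable def NaimarkDilation.kraus (D : NaimarkDilation A K) (x : ℕ) : H →L[ℂ] K :=
  D.pvm.effect x ∘L D.isometry.toContinuousLinearMap

lemma NaimarkDilation.effect_kraus_self (D : NaimarkDilation A K) (x : ℕ) (φ : H) :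
    D.pvm.effect x (D.kraus x φ) = D.kraus x φ :=
  D.pvm.effect_apply_effect_self D.isStarProjection x _

lemma NaimarkDilation.effect_kraus_of_ne (D : NaimarkDilation A K) {x y : ℕ} (h : x ≠ y) (φ : H) :
    D.pvm.effect x (D.kraus y φ) = 0 :=
  D.pvm.effect_apply_effect_of_ne D.isStarProjection h _

lemma NaimarkDilation.inner_kraus (D : NaimarkDilation A K) (x : ℕ) (φ ψ : H) :
    ⟪D.kraus x φ, D.kraus x ψ⟫_ℂ = ⟪φ, A.effect x ψ⟫_ℂ := by
  rw [← D.dilates x]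
  have a := (D.isStarProjection x).isSelfAdjoint.star_eq
  simp only [ContinuousLinearMap.comp_apply, adjoint_inner_right]
  rw [kraus, ContinuousLinearMap.comp_apply, ← adjoint_inner_right, ← star_eq_adjoint, a]
  congr 1
  exact D.effect_kraus_self x ψ

lemma NaimarkDilation.norm_kraus_sq (D : NaimarkDilation A K) (x : ℕ) (φ : H) :
    ‖D.kraus x φ‖ ^ 2 = (⟪φ, A.effect x φ⟫_ℂ).re := by
  rw [← D.inner_kraus]
  exact (inner_self_eq_norm_sq (𝕜 := ℂ) _).symm

lemma NaimarkDilation.hasSum_inner_leastDisturbingChannel (D : NaimarkDilation A K)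
    (C : K →L[ℂ] K) (φ ψ : H) :
    HasSum (fun x => ⟪D.kraus x φ, C (D.kraus x ψ)⟫_ℂ) ⟪φ, D.leastDisturbingChannel C ψ⟫_ℂ :=
  krausSum_inner D.hasSum_norm_sq C φ ψ

/-- Orthogonality of the projections annihilates every Kraus term but one; this produces the
single-operator map needed for the domination argument. -/
lemma NaimarkDilation.inner_leastDisturbingChannel_conjMap (D : NaimarkDilation A K) (x : ℕ)
    (C : K →L[ℂ] K) (φ ψ : H) :
    ⟪φ, D.leastDisturbingChannel (conjMap (D.pvm.effect x) C) ψ⟫_ℂ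
      = ⟪D.kraus x φ, C (D.kraus x ψ)⟫_ℂ := by
  refine (D.hasSum_inner_leastDisturbingChannel _ φ ψ).unique ?_
  simp only [inner_conjMap]
  have h := hasSum_single (f := fun y => ⟪D.pvm.effect x (D.kraus y φ),
    C (D.pvm.effect x (D.kraus y ψ))⟫_ℂ) x fun y hy => by
      simp only [D.effect_kraus_of_ne hy.symm, inner_zero_left]
  simpa only [D.effect_kraus_self] using h

lemma NaimarkDilation.conjMap_effect_one (D : NaimarkDilation A K) (x : ℕ) :
    conjMap (D.pvm.effect x) 1 = D.pvm.effect x := by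
  refine ContinuousLinearMap.ext fun ξ => ext_inner_left ℂ fun η => ?_
  have a := (D.isStarProjection x).isSelfAdjoint.star_eq
  rw [inner_conjMap, one_apply_eq_self, ← adjoint_inner_right, ← star_eq_adjoint, a,
    D.pvm.effect_apply_effect_self D.isStarProjection]

end Dilation

/-! ### From a post-processing of channels to a smearing of observables -/

section PostProcessing

variable {H KA KB : Type*} [NormedAddCommGroup H] [InnerProductSpace ℂ H] [CompleteSpace H]
  [NormedAddCommGroup KA] [InnerProductSpace ℂ KA] [CompleteSpace KA]
  [NormedAddCommGroup KB] [InnerProductSpace ℂ KB] [CompleteSpace KB] {A B : Observable H}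

/-- Scott continuity contains monotonicity, and a linear monotone map is positive. -/
lemma Channel.apply_nonneg (E : Channel KB KA) {C : KB →L[ℂ] KB} (hC : 0 ≤ C) :
    0 ≤ E.toLinearMap C := by
  have h := E.normal'.monotone hC
  have h0 : E.toLinearMap 0 = 0 := map_zero _
  exact h0.symm.le.trans h

/-- The `x`-th operation `C ↦ (Â(x) J)† ℰ(C) (Â(x) J)` of the least disturbing instrument of `A`
followed by the channel `ℰ`. -/
noncomputable def NaimarkDilation.operation (DA : NaimarkDilation A KA) (E : Channel KB KA)
    (x : ℕ) : (KB →L[ℂ] KB) →ₗ[ℂ] (H →L[ℂ] H) :=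
  conjMap (DA.kraus x) ∘ₗ E.toLinearMap

lemma NaimarkDilation.operation_nonneg (DA : NaimarkDilation A KA) (E : Channel KB KA) (x : ℕ)
    {C : KB →L[ℂ] KB} (hC : 0 ≤ C) : 0 ≤ DA.operation E x C := by
  rw [operation, LinearMap.comp_apply]
  exact conjMap_nonneg _ (E.apply_nonneg hC)

lemma NaimarkDilation.re_inner_operation_nonneg (DA : NaimarkDilation A KA) (E : Channel KB KA)
    (x : ℕ) {C : KB →L[ℂ] KB} (hC : 0 ≤ C) (φ : H) :
    0 ≤ (⟪φ, DA.operation E x C φ⟫_ℂ).re :=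
  ((ContinuousLinearMap.nonneg_iff_isPositive _).mp
    (DA.operation_nonneg E x hC)).re_inner_nonneg_right φ

lemma NaimarkDilation.operation_one (DA : NaimarkDilation A KA) (E : Channel KB KA) (x : ℕ)
    (φ : H) : ⟪φ, DA.operation E x 1 φ⟫_ℂ = ⟪φ, A.effect x φ⟫_ℂ := by
  have h1 : E.toLinearMap 1 = 1 := E.map_one'
  rw [operation, LinearMap.comp_apply, inner_conjMap, h1, one_apply_eq_self, inner_kraus]

lemma NaimarkDilation.hasSum_re_inner_operation (DA : NaimarkDilation A KA) (E : Channel KB KA)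
    (C : KB →L[ℂ] KB) (φ : H) :
    HasSum (fun x => (⟪φ, DA.operation E x C φ⟫_ℂ).re)
      (⟪φ, DA.leastDisturbingChannel (E C) φ⟫_ℂ).re := by
  have h := (DA.hasSum_inner_leastDisturbingChannel (E C) φ φ).mapL Complex.reCLM
  simp only [Complex.reCLM_apply, ← inner_conjMap] at h
  exact h

variable {DA : NaimarkDilation A KA} {DB : NaimarkDilation B KB} {E : Channel KB KA}

/-- One term of a nonnegative series is at most its sum. The bound is used twice: for the
proportionality to `B(y)` and to control the tails in `hasSum_operation_effect`. -/
lemma re_inner_operation_le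
    (hE : ∀ C, DB.leastDisturbingChannel C = DA.leastDisturbingChannel (E C)) (x : ℕ)
    {C : KB →L[ℂ] KB} (hC : 0 ≤ C) (φ : H) :
    (⟪φ, DA.operation E x C φ⟫_ℂ).re ≤ (⟪φ, DB.leastDisturbingChannel C φ⟫_ℂ).re := by
  rw [hE]
  exact le_hasSum (DA.hasSum_re_inner_operation E C φ) x
    fun x _ => DA.re_inner_operation_nonneg E x hC φ

lemma re_inner_leastDisturbingChannel_effect (D : NaimarkDilation B KB) (y : ℕ) (φ : H) :
    (⟪φ, D.leastDisturbingChannel (D.pvm.effect y) φ⟫_ℂ).re = ‖D.kraus y φ‖ ^ 2 := by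
  rw [← D.conjMap_effect_one y, D.inner_leastDisturbingChannel_conjMap, one_apply_eq_self]
  exact inner_self_eq_norm_sq (𝕜 := ℂ) _

/-- Purity of `C ↦ (B̂(y) J)† C (B̂(y) J)` makes the operations of `A`, evaluated at `B̂(y)`,
proportional to `B(y)`. -/
lemma operation_effect_mul_comm
    (hE : ∀ C, DB.leastDisturbingChannel C = DA.leastDisturbingChannel (E C)) (x y : ℕ)
    (φ ψ : H) :
    (⟪φ, DA.operation E x (DB.pvm.effect y) φ⟫_ℂ).re * ‖DB.kraus y ψ‖ ^ 2
      = (⟪ψ, DA.operation E x (DB.pvm.effect y) ψ⟫_ℂ).re * ‖DB.kraus y φ‖ ^ 2 := by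
  have h := re_inner_map_one_mul_comm (Φ := DA.operation E x ∘ₗ conjMap (DB.pvm.effect y))
    (W := DB.kraus y)
    (fun C hC φ => DA.re_inner_operation_nonneg E x (conjMap_nonneg _ hC) φ)
    (fun C hC φ => (re_inner_operation_le hE x (conjMap_nonneg _ hC) φ).trans_eq
      (congrArg Complex.re (DB.inner_leastDisturbingChannel_conjMap y C φ φ))) φ ψ
  simpa only [LinearMap.comp_apply, DB.conjMap_effect_one] using h

/-- The tail `1 - ∑ y ∈ s, B̂(y)` is positive, so its image under the operation is dominated by its
image under `Λ_B`, whose expectation `‖φ‖² - ∑ y ∈ s, ‖K_y φ‖²` tends to zero. What remains is the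
value of the operation at `1`, namely `A(x)`. -/
lemma hasSum_operation_effect
    (hE : ∀ C, DB.leastDisturbingChannel C = DA.leastDisturbingChannel (E C)) (x : ℕ) (φ : H) :
    HasSum (fun y => (⟪φ, DA.operation E x (DB.pvm.effect y) φ⟫_ℂ).re)
      (⟪φ, A.effect x φ⟫_ℂ).re := by
  have hB : HasSum (fun y => ‖DB.kraus y φ‖ ^ 2) (‖φ‖ ^ 2) := DB.hasSum_norm_sq φ
  have hzero : Tendsto (fun s : Finset ℕ =>
      (⟪φ, DA.operation E x (1 - ∑ y ∈ s, DB.pvm.effect y) φ⟫_ℂ).re) atTop (𝓝 0) := by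
    have hlim : Tendsto (fun s : Finset ℕ => ‖φ‖ ^ 2 - ∑ y ∈ s, ‖DB.kraus y φ‖ ^ 2) atTop (𝓝 0) := by
      have h := Tendsto.const_sub (‖φ‖ ^ 2) hB
      rwa [sub_self] at h
    refine squeeze_zero
      (fun s => DA.re_inner_operation_nonneg E x (DB.pvm.one_sub_sum_effect_nonneg s) φ)
      (fun s => (re_inner_operation_le hE x (DB.pvm.one_sub_sum_effect_nonneg s) φ).trans_eq ?_) hlim
    have hmap : DB.leastDisturbingChannel (1 - ∑ y ∈ s, DB.pvm.effect y)
        = 1 - ∑ y ∈ s, DB.leastDisturbingChannel (DB.pvm.effect y) := by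
      have h := map_sub DB.leastDisturbingChannel.toLinearMap 1 (∑ y ∈ s, DB.pvm.effect y)
      rw [map_sum] at h
      exact h.trans (congrArg (· - _) DB.leastDisturbingChannel.map_one')
    have h1 : (⟪φ, φ⟫_ℂ).re = ‖φ‖ ^ 2 := inner_self_eq_norm_sq (𝕜 := ℂ) φ
    rw [hmap, _root_.sub_apply, inner_sub_right, Complex.sub_re, one_apply_eq_self, h1,
      _root_.sum_apply, inner_sum, Complex.re_sum]
    simp only [re_inner_leastDisturbingChannel_effect]
  have h := (tendsto_const_nhds (x := (⟪φ, A.effect x φ⟫_ℂ).re)).sub hzero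
  rw [sub_zero] at h
  refine h.congr fun s => ?_
  rw [map_sub, map_sum, _root_.sub_apply, inner_sub_right, Complex.sub_re, DA.operation_one,
    sub_sub_cancel, _root_.sum_apply, inner_sum, Complex.re_sum]

theorem smearingOf_of_postProcessingOf
    (h : DB.leastDisturbingChannel.PostProcessingOf DA.leastDisturbingChannel) :
    A.SmearingOf B := by
  obtain ⟨E, hE⟩ := h
  set g : ℕ → ℕ → H → ℝ := fun x y φ => (⟪φ, DA.operation E x (DB.pvm.effect y) φ⟫_ℂ).re with hg
  have hg0 : ∀ x y φ, 0 ≤ g x y φ := fun x y φ => DA.re_inner_operation_nonneg E x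
    ((ContinuousLinearMap.nonneg_iff_isPositive _).mpr (DB.pvm.isPositive y)) φ
  have hgx : ∀ y φ, HasSum (fun x => g x y φ) (‖DB.kraus y φ‖ ^ 2) := fun y φ => by
    rw [← re_inner_leastDisturbingChannel_effect, hE]
    exact DA.hasSum_re_inner_operation E _ φ
  have hcol : ∀ y, ∃ m : ℕ → ℝ, (∀ x, 0 ≤ m x) ∧ HasSum m 1 ∧
      ∀ x φ, g x y φ = m x * ‖DB.kraus y φ‖ ^ 2 := by
    intro y
    by_cases hy : ∃ ψ, DB.kraus y ψ ≠ 0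
    · obtain ⟨ψ, hψ⟩ := hy
      have hψ2 : ‖DB.kraus y ψ‖ ^ 2 ≠ 0 := by simpa using hψ
      -- By proportionality the ratio does not depend on the vector, so any `ψ` with `K_y ψ ≠ 0` may
      -- define the column.
      refine ⟨fun x => g x y ψ / ‖DB.kraus y ψ‖ ^ 2,
        fun x => div_nonneg (hg0 x y ψ) (by positivity), ?_, fun x φ => ?_⟩
      · have h := (hgx y ψ).div_const (‖DB.kraus y ψ‖ ^ 2)
        rwa [div_self hψ2] at h
      · rw [div_mul_eq_mul_div, eq_div_iff hψ2]
        exact operation_effect_mul_comm hE x y φ ψ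
    · push Not at hy
      -- Here `B(y) = 0`, so the column has no effect on the sum; a point mass keeps the matrix
      -- stochastic.
      refine ⟨fun x => if x = 0 then 1 else 0, fun x => by positivity, hasSum_ite_eq 0 1,
        fun x φ => ?_⟩
      have h := hgx y φ
      rw [hy φ, norm_zero, zero_pow two_ne_zero] at h
      rw [hy φ, norm_zero, zero_pow two_ne_zero, mul_zero]
      exact congrFun ((hasSum_zero_iff_of_nonneg fun x => hg0 x y φ).mp h) x
  choose m hm0 hm1 hm using hcol
  refine ⟨fun x y => m y x, ⟨fun x y => hm0 y x, hm1⟩, fun x => ?_⟩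
  refine hasWOTSum_of_re_inner
    (fun y => IsSelfAdjoint.smul (Complex.conj_ofReal _) (B.isPositive y).isSelfAdjoint)
    (A.isPositive x).isSelfAdjoint fun φ => ?_
  refine (hasSum_operation_effect hE x φ).congr_fun fun y => ?_
  rw [_root_.smul_apply, inner_smul_right, Complex.re_ofReal_mul, ← DB.norm_kraus_sq]
  exact (hm y x φ).symm

end PostProcessing

/-! ### Extending an isometry to a full family of Kraus operators -/

section KrausExtension

variable {H K K' ι : Type*} [NormedAddCommGroup H] [InnerProductSpace ℂ H]
  [NormedAddCommGroup K] [InnerProductSpace ℂ K] [CompleteSpace K]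
  [NormedAddCommGroup K'] [InnerProductSpace ℂ K'] [CompleteSpace K']

/-- The isometry `S φ ↦ (T i φ)ᵢ` on the closure `L` of the range of `S`, by components, and
extended by zero to the orthogonal complement of `L`. -/
lemma exists_comp_eq_of_hasSum_norm_sq (S : H →L[ℂ] K) (T : ι → H →L[ℂ] K')
    (h : ∀ φ, HasSum (fun i => ‖T i φ‖ ^ 2) (‖S φ‖ ^ 2)) :
    ∃ (L : Submodule ℂ K) (_ : L.HasOrthogonalProjection) (V : ι → K →L[ℂ] K'),
      (∀ φ, S φ ∈ L) ∧ (∀ i φ, V i (S φ) = T i φ) ∧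
      ∀ ξ, HasSum (fun i => ‖V i ξ‖ ^ 2) (‖L.starProjection ξ‖ ^ 2) := by
  have h2 : (0 : ℝ) < (2 : ENNReal).toReal := by norm_num
  have hmem : ∀ φ, Memℓp (fun i => T i φ) 2 := fun φ =>
    memℓp_gen (by simpa using (h φ).summable)
  let Z : H →ₗ[ℂ] lp (fun _ : ι => K') 2 :=
    { toFun := fun φ => ⟨fun i => T i φ, hmem φ⟩
      map_add' := fun φ ψ => by ext i; exact map_add (T i) φ ψ
      map_smul' := fun c φ => by ext i; exact map_smul (T i) c φ }
  have hZ : ∀ φ, ‖Z φ‖ = ‖S φ‖ := fun φ => by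
    have h1 := lp.hasSum_norm h2 (Z φ)
    simp only [ENNReal.toReal_ofNat, Real.rpow_two] at h1
    exact (sq_eq_sq₀ (norm_nonneg _) (norm_nonneg _)).mp (h1.unique (h φ))
  let L : Submodule ℂ K := (LinearMap.range S.toLinearMap).topologicalClosure
  have hL : ∀ φ, S φ ∈ L := fun φ => Submodule.le_topologicalClosure _ ⟨φ, rfl⟩
  have : CompleteSpace L := (Submodule.isClosed_topologicalClosure _).completeSpace_coe
  let e : H →ₗ[ℂ] L := S.toLinearMap.codRestrict L hL
  have he : DenseRange e := by
    intro ξ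
    rw [Topology.IsEmbedding.subtypeVal.closure_eq_preimage_closure_image]
    show (ξ : K) ∈ closure _
    have hr : Subtype.val '' Set.range e = LinearMap.range S.toLinearMap := by
      rw [← Set.range_comp]; rfl
    rw [hr]
    exact ξ.2
  -- This bound makes `Z` factor through `e` even when `S` is not injective, and extend continuously
  -- from the dense range of `e` to `L`.
  have hbd : ∀ φ, ‖Z φ‖ ≤ 1 * ‖e φ‖ := fun φ => by rw [one_mul]; exact (hZ φ).le
  let Y : L →L[ℂ] lp (fun _ : ι => K') 2 := Z.extendOfNorm e
  have hYe : ∀ φ, Y (e φ) = Z φ := fun φ => LinearMap.extendOfNorm_eq he ⟨1, hbd⟩ φ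
  have hY : ∀ ξ, ‖Y ξ‖ = ‖ξ‖ := fun ξ => by
    refine he.induction_on (p := fun ξ => ‖Y ξ‖ = ‖ξ‖) ξ
      (isClosed_eq (by fun_prop) (by fun_prop)) fun φ => ?_
    rw [hYe, hZ]; rfl
  refine ⟨L, inferInstance,
    fun i => lp.evalCLM ℂ (fun _ : ι => K') 2 i ∘L Y ∘L L.orthogonalProjectionOnto, hL,
    fun i φ => ?_, fun ξ => ?_⟩
  · have hp : L.orthogonalProjectionOnto (S φ) = e φ :=
      Submodule.orthogonalProjectionOnto_mem_subspace_eq_self (e φ)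
    rw [ContinuousLinearMap.comp_apply, ContinuousLinearMap.comp_apply, hp, hYe]
    rfl
  · have h1 := lp.hasSum_norm h2 (Y (L.orthogonalProjectionOnto ξ))
    simp only [ENNReal.toReal_ofNat, Real.rpow_two, hY] at h1
    exact h1

/-- Kraus operators of a channel that turn `S` into the family `T`, when
`∑ i, (T i)† (T i) = S† S`. -/
lemma exists_kraus_extension [Nontrivial K'] {w : Set K} (b : HilbertBasis w ℂ K)
    (S : H →L[ℂ] K) (T : ι → H →L[ℂ] K')
    (h : ∀ φ, HasSum (fun i => ‖T i φ‖ ^ 2) (‖S φ‖ ^ 2)) :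
    ∃ V : ι ⊕ w → K →L[ℂ] K', (∀ ξ, HasSum (fun k => ‖V k ξ‖ ^ 2) (‖ξ‖ ^ 2)) ∧
      (∀ i φ, V (.inl i) (S φ) = T i φ) ∧ ∀ j φ, V (.inr j) (S φ) = 0 := by
  obtain ⟨L, hLproj, V, hSL, hVS, hV⟩ := exists_comp_eq_of_hasSum_norm_sq S T h
  obtain ⟨e, he⟩ := exists_norm_eq K' (zero_le_one' ℝ)
  -- On `Lᗮ` the added operators send everything to the fixed unit vector `e`. By Parseval for `b`,
  -- their squared norms sum to `‖Lᗮ.starProjection ξ‖ ^ 2`, exactly what `V` misses; they vanish on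
  -- the range of `S`, which lies in `L`.
  refine ⟨Sum.elim V fun j => InnerProductSpace.rankOne ℂ e (b j) ∘L Lᗮ.starProjection,
    fun ξ => ?_, hVS, fun j φ => ?_⟩
  · rw [Submodule.norm_sq_eq_add_norm_sq_starProjection ξ L]
    refine HasSum.sum (hV ξ) ?_
    have hb := (b.hasSum_inner_mul_inner (Lᗮ.starProjection ξ) (Lᗮ.starProjection ξ)).mapL
      Complex.reCLM
    have h1 : (⟪Lᗮ.starProjection ξ, Lᗮ.starProjection ξ⟫_ℂ).re = ‖Lᗮ.starProjection ξ‖ ^ 2 :=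
      inner_self_eq_norm_sq (𝕜 := ℂ) _
    rw [Complex.reCLM_apply, h1] at hb
    refine hb.congr_fun fun j => ?_
    simp only [Function.comp_apply, Sum.elim_inr, ContinuousLinearMap.comp_apply,
      InnerProductSpace.rankOne_apply, norm_smul, he, mul_one, Complex.reCLM_apply]
    rw [← inner_conj_symm (Lᗮ.starProjection ξ), Complex.conj_mul', ← Complex.ofReal_pow, Complex.ofReal_re]
  · have h0 : Lᗮ.starProjection (S φ) = 0 := by
      rw [Submodule.starProjection_orthogonal_apply_eq_zero]
      exact hSL φ
    simp [h0]

end KrausExtension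

/-! ### From a smearing of observables to a post-processing of channels -/

section Smearing

variable {H KA KB : Type*} [NormedAddCommGroup H] [InnerProductSpace ℂ H] [CompleteSpace H]
  [NormedAddCommGroup KA] [InnerProductSpace ℂ KA] [CompleteSpace KA]
  [NormedAddCommGroup KB] [InnerProductSpace ℂ KB] [CompleteSpace KB] {A B : Observable H}
  {DA : NaimarkDilation A KA} {DB : NaimarkDilation B KB}

lemma hasSum_prod_of_nonneg {α β : Type*} {f : α × β → ℝ} (hf : ∀ p, 0 ≤ f p) {g : α → ℝ} {a : ℝ}
    (hg : ∀ x, HasSum (fun y => f (x, y)) (g x)) (ha : HasSum g a) : HasSum f a := by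
  have hs : Summable f := (summable_prod_of_nonneg hf).mpr
    ⟨fun x => (hg x).summable, by simpa only [(hg _).tsum_eq] using ha.summable⟩
  have h := hs.hasSum.prod_fiberwise hg
  rw [ha.unique h]
  exact hs.hasSum

/-- The columns of a stochastic matrix integrate out of an absolutely convergent series. -/
lemma IsStochasticMatrix.hasSum_mul {M : ℕ → ℕ → ℝ} (hM : IsStochasticMatrix M) {c : ℕ → ℂ}
    {a : ℂ} (hc : Summable fun y => ‖c y‖) (ha : HasSum c a) :
    HasSum (fun p : ℕ × ℕ => (M p.1 p.2 : ℂ) * c p.2) a := by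
  have hs : Summable fun p : ℕ × ℕ => (M p.2 p.1 : ℂ) * c p.1 := by
    refine Summable.of_norm ?_
    refine (hasSum_prod_of_nonneg (fun _ => norm_nonneg _) (g := fun y => ‖c y‖)
      (fun y => ?_) hc.hasSum).summable
    simpa [abs_of_nonneg (hM.nonneg _ _)] using (hM.hasSum_one y).mul_right ‖c y‖
  have h := hs.hasSum.prod_fiberwise (g := c) fun y => by
    simpa using ((hM.hasSum_one y).mapL Complex.ofRealCLM).mul_right (c y)
  have h2 : HasSum (fun p : ℕ × ℕ => (M p.2 p.1 : ℂ) * c p.1) a := ha.unique h ▸ hs.hasSum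
  -- The series was summed over `x` first, to use the columns; exchanging the factors lets it later
  -- be summed over `y` first.
  exact (Equiv.prodComm ℕ ℕ).hasSum_iff.mp h2

theorem postProcessingOf_of_smearingOf [Nontrivial H] (h : A.SmearingOf B) :
    DB.leastDisturbingChannel.PostProcessingOf DA.leastDisturbingChannel := by
  obtain ⟨M, hM, hMA⟩ := h
  -- This supplies the unit vector needed to complete the Kraus families on orthogonal complements.
  have : Nontrivial KB := DB.isometry.injective.nontrivial
  obtain ⟨w, b, -⟩ := exists_hilbertBasis ℂ KA
  have hnorm : ∀ x φ, HasSum (fun y => ‖(((√(M x y) : ℝ) : ℂ) • DB.kraus y) φ‖ ^ 2)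
      (‖DA.kraus x φ‖ ^ 2) := by
    intro x φ
    have h := (hasWOTSum_iff.mp (hMA x) φ φ).mapL Complex.reCLM
    rw [Complex.reCLM_apply, ← DA.norm_kraus_sq] at h
    refine h.congr_fun fun y => ?_
    rw [Complex.reCLM_apply, _root_.smul_apply, _root_.smul_apply, inner_smul_right,
      Complex.re_ofReal_mul, ← DB.norm_kraus_sq, norm_smul, mul_pow, Complex.norm_real,
      Real.norm_of_nonneg (Real.sqrt_nonneg _), Real.sq_sqrt (hM.nonneg x y)]
  choose V hV1 hVT hV0 using fun x => exists_kraus_extension b (DA.kraus x)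
    (fun y => ((√(M x y) : ℝ) : ℂ) • DB.kraus y) (hnorm x)
  -- The Kraus operators of `ℰ` are `V x k ∘ Â(x)`: the measurement of `Â` followed by the channel
  -- selected by its outcome.
  have hK : ∀ ξ, HasSum (fun p : ℕ × (ℕ ⊕ w) => ‖(V p.1 p.2 ∘L DA.pvm.effect p.1) ξ‖ ^ 2)
      (‖ξ‖ ^ 2) := fun ξ =>
    hasSum_prod_of_nonneg (fun _ => by positivity) (fun x => hV1 x (DA.pvm.effect x ξ))
      (DA.pvm.hasSum_norm_sq_of_isStarProjection DA.isStarProjection ξ)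
  refine ⟨Channel.ofKraus _ hK, fun C => ?_⟩
  refine ContinuousLinearMap.ext fun ψ => ext_inner_left ℂ fun φ => ?_
  set c : ℕ → ℂ := fun y => ⟪DB.kraus y φ, C (DB.kraus y ψ)⟫_ℂ with hc
  have hx : ∀ x, HasSum (fun y => (M x y : ℂ) * c y)
      ⟪DA.kraus x φ, Channel.ofKraus _ hK C (DA.kraus x ψ)⟫_ℂ := by
    intro x
    have h1 := krausSum_inner hK C (DA.kraus x φ) (DA.kraus x ψ)
    -- On the range of `L_x` only the indices `(x, inl y)` contribute: another outcome is
    -- annihilated by orthogonality, and the operators `V x (inr j)` vanish there.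
    have hinj : Function.Injective fun y : ℕ => ((x, Sum.inl y) : ℕ × (ℕ ⊕ w)) := fun y z hyz => by
      simpa using hyz
    refine ((hinj.hasSum_iff fun p hp => ?_).mpr h1).congr_fun fun y => ?_
    · obtain ⟨x', k⟩ := p
      by_cases hxx : x' = x
      · subst hxx
        cases k with
        | inl y => exact absurd ⟨y, rfl⟩ hp
        | inr j =>
          simp only [ContinuousLinearMap.comp_apply, DA.effect_kraus_self, hV0, inner_zero_left]
      · simp only [ContinuousLinearMap.comp_apply, DA.effect_kraus_of_ne hxx, map_zero,
          inner_zero_left]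
    · simp only [Function.comp_apply, ContinuousLinearMap.comp_apply, DA.effect_kraus_self, hVT,
        _root_.smul_apply, map_smul, inner_smul_left, inner_smul_right, hc]
      rw [Complex.conj_ofReal, ← mul_assoc, ← Complex.ofReal_mul,
        Real.mul_self_sqrt (hM.nonneg x y)]
  have hB := DB.hasSum_inner_leastDisturbingChannel C φ ψ
  have habs : Summable fun y => ‖c y‖ := summable_norm_iff.mpr hB.summable
  -- Both orders of summation of one absolutely convergent double series: over `x` first it gives
  -- `Λ_B(C)`, over `y` first it gives `Λ_A(ℰ(C))`.
  have h1 := (hM.hasSum_mul habs hB).prod_fiberwise hx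
  exact h1.unique (DA.hasSum_inner_leastDisturbingChannel _ φ ψ)

end Smearing

end QuantumMeasurement

open QuantumMeasurement in
theorem mainTheorem3 {H KA KB : Type*}
    [NormedAddCommGroup H] [InnerProductSpace ℂ H] [CompleteSpace H] [Nontrivial H]
    [NormedAddCommGroup KA] [InnerProductSpace ℂ KA] [CompleteSpace KA]
    [NormedAddCommGroup KB] [InnerProductSpace ℂ KB] [CompleteSpace KB]
    (A B : Observable H) (DA : NaimarkDilation A KA) (DB : NaimarkDilation B KB) :
    A.SmearingOf B ↔ DB.leastDisturbingChannel.PostProcessingOf DA.leastDisturbingChannel :=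
  ⟨postProcessingOf_of_smearingOf, smearingOf_of_postProcessingOf⟩
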